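/- Let $F$ be an infinite field of characteristic different from $2$, with separable closure $F_s$, and let $\Gamma=\mathrm{Gal}(F_s/F)$. **Triality.** Let $W(D_4)\subset O_4(\mathbb R)$ be the group of matrices $\mathrm{diag}(\varepsilon_1,\dots,\varepsilon_4)\cdot P(\pi)$, where $P(\pi)$ is a permutation matrix, $\varepsilon_i=\pm1$ and $\prod_i\varepsilon_i=1$. Let $$\mu=\frac12\begin{pmatrix}1&1&1&-1\\1&1&-1&1\\1&-1&1&1\\1&-1&-1&-1\end{pmatrix},$$ so that $\mu^3=1$, and conjugation by $\mu$ induces an outer automorphism $\tilde\mu$ of order $3$ of $W(D_4)$. Let $H^1(F,W(D_4))$ be the set of continuous homomorphisms $\Gamma\to W(D_4)$ up to conjugation in $W(D_4)$, and let $\tilde\mu_*$ be the map $[\varphi]\mapsto[\tilde\mu\circ\varphi]$ on it. Let $S/S_0$ be an extension of degree $2$ of étale $F$-algebras with $\dim_F S_0=4$ (so $\dim_F S=8$), and for an $F$-algebra $T$ let $X(T)=\mathrm{Hom}_{F\text{-alg}}(T,F_s)$. We say that $S/S_0$ has class $[\varphi]\in H^1(F,W(D_4))$ if the double covering of $\Gamma$-sets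 $X(S)\to X(S_0)$ is isomorphic to the covering $\{\pm e_1,\dots,\pm e_4\}\to\{1,\dots,4\}$, $\pm e_i\mapsto i$, with $\Gamma$ acting through $\varphi$. (Such a class exists if and only if $S$ has trivial discriminant; it depends on the choice of an orientation of $S$.) The isomorphism classes of three such extensions $S/S_0$, $S'/S_0'$, $S''/S_0''$ are *in triality* if there is $\xi\in H^1(F,W(D_4))$ such that $S/S_0$ has class $\xi$, $S'/S_0'$ has class $\tilde\mu_*\xi$ and $S''/S_0''$ has class $\tilde\mu_*^2\xi$. **Theorem.** Let $S/S_0$ be an extension of degree $2$ of étale $F$-algebras with $\dim_FS_0=4$ that is given by a polynomial $$f_4(x)=x^4+ax^3+bx^2+cx+e^2,\qquad a,b,c,e\in F,$$ that is, $S/S_0$ is isomorphic to $\big(F[x]/(f_4(x^2))\big)/\big(F[x]/(f_4(x))\big)$, where $F[x]/(f_4(x))\to F[x]/(f_4(x^2))$ maps $x$ to $x^2$. (Then $S$ has trivial discriminant.) Let $$f_4'(x)=x^4+ax^3+\big(\tfrac38a^2-\tfrac12b+3e\big)x^2+\big(\tfrac1{16}a^3-\tfrac14ab+c+\tfrac12ae\big)x+\big(\tfrac1{16}a^2-\tfrac14b-\tfrac12e\big)^2,$$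 $$f_4''(x)=x^4+ax^3+\big(\tfrac38a^2-\tfrac12b-3e\big)x^2+\big(\tfrac1{16}a^3-\tfrac14ab+c-\tfrac12ae\big)x+\big(\tfrac1{16}a^2-\tfrac14b+\tfrac12e\big)^2.$$ Then there is a class $\xi\in H^1(F,W(D_4))$ of $S/S_0$ such that: 1. if $\tfrac1{16}a^2-\tfrac14b-\tfrac12e\neq0$, then $f_4'$ defines in the same way an extension $S'/S_0'$ of degree $2$ of étale algebras, with $\dim_F S_0'=4$, and $S'/S_0'$ has class $\tilde\mu_*\xi$; 2. if $\tfrac1{16}a^2-\tfrac14b+\tfrac12e\neq0$, then $f_4''$ defines in the same way an extension $S''/S_0''$ of degree $2$ of étale algebras, with $\dim_F S_0''=4$, and $S''/S_0''$ has class $\tilde\mu_*^2\xi$. In particular, if $f_4'(0)\neq0$ and $f_4''(0)\neq0$, the isomorphism classes of $S/S_0$, $S'/S_0'$ and $S''/S_0''$ are in triality. -/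

import Mathlib

open Polynomial

open scoped Matrix

namespace Triality

/-! ### The Weyl group of type `D₄` and its trialitarian automorphism -/

/-- The signed permutation matrix `diag(ε) · P(π)`. -/
noncomputable def signedPerm (ε : Fin 4 → ℤˣ) (π : Equiv.Perm (Fin 4)) :
    Matrix (Fin 4) (Fin 4) ℝ :=
  Matrix.diagonal (fun i => ((ε i : ℤ) : ℝ)) * π.permMatrix ℝ

theorem signedPerm_apply (ε : Fin 4 → ℤˣ) (π : Equiv.Perm (Fin 4)) (i j : Fin 4) :
    signedPerm ε π i j = if π i = j then ((ε i : ℤ) : ℝ) else 0 := by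
  simp [signedPerm, Matrix.diagonal_mul, Equiv.Perm.permMatrix, PEquiv.toMatrix_apply, eq_comm]

theorem signedPerm_mul (ε δ : Fin 4 → ℤˣ) (π ρ : Equiv.Perm (Fin 4)) :
    signedPerm ε π * signedPerm δ ρ = signedPerm (fun i => ε i * δ (π i)) (ρ * π) := by
  ext i j
  rw [Matrix.mul_apply, Finset.sum_eq_single (π i)]
  · simp [signedPerm_apply]
  · intro k _ hk
    simp [signedPerm_apply, hk.symm]
  · simp

theorem signedPerm_one : signedPerm (fun _ => 1) 1 = 1 := by
  simp [signedPerm]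

theorem prod_comp_mul (ε δ : Fin 4 → ℤˣ) (π : Equiv.Perm (Fin 4))
    (hε : ∏ i, ε i = 1) (hδ : ∏ i, δ i = 1) : ∏ i, ε i * δ (π i) = 1 := by
  rw [Finset.prod_mul_distrib, hε, Equiv.prod_comp π δ, hδ, one_mul]

/-- The Weyl group `W(D₄)`, as a subgroup of the orthogonal group `O₄`: the matrices
`diag(ε₁, ε₂, ε₃, ε₄) · P(π)` with `π` a permutation, `εᵢ = ± 1` and `∏ εᵢ = 1`. -/
noncomputable def weylD4 : Subgroup (Matrix.orthogonalGroup (Fin 4) ℝ) where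
  carrier := {g | ∃ (ε : Fin 4 → ℤˣ) (π : Equiv.Perm (Fin 4)), ∏ i, ε i = 1 ∧
    (g : Matrix (Fin 4) (Fin 4) ℝ) = signedPerm ε π}
  mul_mem' := by
    rintro g h ⟨ε, π, hε, hg⟩ ⟨δ, ρ, hδ, hh⟩
    exact ⟨_, _, prod_comp_mul ε δ π hε hδ, by
      rw [← signedPerm_mul, ← hg, ← hh]; rfl⟩
  one_mem' := ⟨fun _ => 1, 1, by simp, by rw [signedPerm_one]; rfl⟩
  inv_mem' := by
    rintro g ⟨ε, π, hε, hg⟩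
    refine ⟨fun i => ε (π⁻¹ i), π⁻¹, ?_, ?_⟩
    · rw [Equiv.prod_comp π⁻¹ ε, hε]
    · have h1 : (g : Matrix (Fin 4) (Fin 4) ℝ) * signedPerm (fun i => ε (π⁻¹ i)) π⁻¹ = 1 := by
        rw [hg, signedPerm_mul, ← signedPerm_one]
        simp
      have h2 : ((g⁻¹ : Matrix.orthogonalGroup (Fin 4) ℝ) : Matrix (Fin 4) (Fin 4) ℝ) *
          (g : Matrix (Fin 4) (Fin 4) ℝ) = 1 :=
        congrArg Subtype.val (inv_mul_cancel g)
      exact left_inv_eq_right_inv h2 h1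

theorem mem_weylD4 {g : Matrix.orthogonalGroup (Fin 4) ℝ} :
    g ∈ weylD4 ↔ ∃ (ε : Fin 4 → ℤˣ) (π : Equiv.Perm (Fin 4)), ∏ i, ε i = 1 ∧
      (g : Matrix (Fin 4) (Fin 4) ℝ) = signedPerm ε π := Iff.rfl

/-- The orthogonal matrix `μ` of order three. It extends to `ℝ⁴` the automorphism
`α₁ ↦ α₄ ↦ α₃ ↦ α₁`, `α₂ ↦ α₂` of the Dynkin diagram of the simple roots
`α₁ = e₁ - e₂`, `α₂ = e₂ - e₃`, `α₃ = e₃ - e₄`, `α₄ = e₃ + e₄`. -/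
noncomputable def muMatrix : Matrix (Fin 4) (Fin 4) ℝ :=
  (1 / 2 : ℝ) • !![1, 1, 1, -1; 1, 1, -1, 1; 1, -1, 1, 1; 1, -1, -1, -1]

theorem muMatrix_mul_transpose : muMatrix * muMatrixᵀ = 1 := by
  ext i j
  fin_cases i <;> fin_cases j <;>
    simp [muMatrix, Matrix.mul_apply, Fin.sum_univ_four] <;> norm_num

/-- The matrix `μ` as an element of `O₄`. -/
noncomputable def mu : Matrix.orthogonalGroup (Fin 4) ℝ :=
  ⟨muMatrix, (Matrix.mem_orthogonalGroup_iff (Fin 4) ℝ).2 muMatrix_mul_transpose⟩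

/-- The relation `μ A μ⁻¹ ∈ W(D₄)`, at the level of matrices. -/
def ConjMem (A : Matrix (Fin 4) (Fin 4) ℝ) : Prop :=
  ∃ (ε : Fin 4 → ℤˣ) (π : Equiv.Perm (Fin 4)), ∏ i, ε i = 1 ∧
    muMatrix * A = signedPerm ε π * muMatrix

theorem ConjMem.mul {A B : Matrix (Fin 4) (Fin 4) ℝ} (hA : ConjMem A) (hB : ConjMem B) :
    ConjMem (A * B) := by
  obtain ⟨ε, π, hε, h⟩ := hA
  obtain ⟨δ, ρ, hδ, h'⟩ := hB
  exact ⟨_, _, prod_comp_mul ε δ π hε hδ, by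
    rw [← signedPerm_mul, ← Matrix.mul_assoc, h, Matrix.mul_assoc, h', Matrix.mul_assoc]⟩

theorem eq_of_prod_eq_one : ∀ ε : Fin 4 → ℤˣ, ∏ i, ε i = 1 →
    ε = ![1, 1, 1, 1] ∨ ε = ![1, 1, -1, -1] ∨ ε = ![1, -1, 1, -1] ∨ ε = ![1, -1, -1, 1] ∨
    ε = ![-1, 1, 1, -1] ∨ ε = ![-1, 1, -1, 1] ∨ ε = ![-1, -1, 1, 1] ∨
    ε = ![-1, -1, -1, -1] := by
  decide

theorem conj_check (ε δ : Fin 4 → ℤˣ) (π ρ : Equiv.Perm (Fin 4)) (hδ : ∏ i, δ i = 1)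
    (h : ∀ i j, (!![1, 1, 1, -1; 1, 1, -1, 1; 1, -1, 1, 1; 1, -1, -1, -1] :
        Matrix (Fin 4) (Fin 4) ℤ) i (π.symm j) * ε (π.symm j) =
      δ i * (!![1, 1, 1, -1; 1, 1, -1, 1; 1, -1, 1, 1; 1, -1, -1, -1] :
        Matrix (Fin 4) (Fin 4) ℤ) (ρ i) j) : ConjMem (signedPerm ε π) := by
  refine ⟨δ, ρ, hδ, ?_⟩
  have key : muMatrix = (1 / 2 : ℝ) • (!![1, 1, 1, -1; 1, 1, -1, 1; 1, -1, 1, 1; 1, -1, -1, -1] :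
      Matrix (Fin 4) (Fin 4) ℤ).map (fun n => (n : ℝ)) := by
    rw [muMatrix]
    congr 1
    ext i j
    fin_cases i <;> fin_cases j <;> simp
  rw [key, Matrix.smul_mul, Matrix.mul_smul]
  congr 1
  ext i j
  have hij := congrArg (fun n : ℤ => (n : ℝ)) (h i j)
  simp only [Int.cast_mul] at hij
  rw [Matrix.mul_apply, Matrix.mul_apply, Finset.sum_eq_single (π.symm j),
    Finset.sum_eq_single (ρ i)]
  · simpa only [signedPerm_apply, Matrix.map_apply, Equiv.apply_symm_apply, if_true] using hij
  · intro k _ hk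
    rw [signedPerm_apply, if_neg hk.symm, zero_mul]
  · simp
  · intro k _ hk
    rw [signedPerm_apply, if_neg (fun h => hk ((Equiv.eq_symm_apply π).2 h)), mul_zero]
  · simp

theorem conjMem_swap (i j : Fin 4) : ConjMem (signedPerm (fun _ => 1) (Equiv.swap i j)) := by
  wlog hij : i ≤ j generalizing i j
  · rw [Equiv.swap_comm]
    exact this j i (le_of_not_ge hij)
  fin_cases i <;> fin_cases j <;> first
    | exact absurd hij (by decide)
    | exact conj_check _ (fun _ => 1) _ 1 (by decide) (by decide)
    | exact conj_check _ ![1, 1, -1, -1] _ (Equiv.swap 2 3) (by decide) (by decide)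
    | exact conj_check _ ![1, -1, 1, -1] _ (Equiv.swap 1 3) (by decide) (by decide)
    | exact conj_check _ ![-1, 1, 1, -1] _ (Equiv.swap 0 3) (by decide) (by decide)
    | exact conj_check _ (fun _ => 1) _ (Equiv.swap 1 2) (by decide) (by decide)
    | exact conj_check _ (fun _ => 1) _ (Equiv.swap 0 2) (by decide) (by decide)
    | exact conj_check _ (fun _ => 1) _ (Equiv.swap 0 1) (by decide) (by decide)

theorem conjMem_diag (ε : Fin 4 → ℤˣ) (hε : ∏ i, ε i = 1) : ConjMem (signedPerm ε 1) := by
  rcases eq_of_prod_eq_one ε hε with h | h | h | h | h | h | h | h <;> subst h <;> first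
    | exact conj_check _ (fun _ => 1) _ 1 (by decide) (by decide)
    | exact conj_check _ (fun _ => -1) _ 1 (by decide) (by decide)
    | exact conj_check _ (fun _ => 1) _ (Equiv.swap 0 1 * Equiv.swap 2 3) (by decide) (by decide)
    | exact conj_check _ (fun _ => 1) _ (Equiv.swap 0 2 * Equiv.swap 1 3) (by decide) (by decide)
    | exact conj_check _ (fun _ => 1) _ (Equiv.swap 0 3 * Equiv.swap 1 2) (by decide) (by decide)
    | exact conj_check _ (fun _ => -1) _ (Equiv.swap 0 1 * Equiv.swap 2 3) (by decide) (by decide)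
    | exact conj_check _ (fun _ => -1) _ (Equiv.swap 0 2 * Equiv.swap 1 3) (by decide) (by decide)
    | exact conj_check _ (fun _ => -1) _ (Equiv.swap 0 3 * Equiv.swap 1 2) (by decide) (by decide)

theorem conjMem_perm (π : Equiv.Perm (Fin 4)) : ConjMem (signedPerm (fun _ => 1) π) := by
  induction π using Equiv.Perm.swap_induction_on with
  | one => exact conjMem_diag _ (by simp)
  | swap_mul f x y _ hf =>
    have h : signedPerm (fun _ => 1) (Equiv.swap x y * f) =
        signedPerm (fun _ => 1) f * signedPerm (fun _ => 1) (Equiv.swap x y) := by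
      rw [signedPerm_mul]
      simp
    rw [h]
    exact hf.mul (conjMem_swap x y)

/-- Conjugation by `μ` preserves `W(D₄)`. -/
theorem mu_conj_mem (w : weylD4) :
    mu * (w : Matrix.orthogonalGroup (Fin 4) ℝ) * mu⁻¹ ∈ weylD4 := by
  obtain ⟨ε, π, hε, hw⟩ := w.2
  have h : signedPerm ε π = signedPerm ε 1 * signedPerm (fun _ => 1) π := by
    rw [signedPerm_mul]
    simp
  obtain ⟨δ, ρ, hδ, hc⟩ := (conjMem_diag ε hε).mul (conjMem_perm π)
  refine ⟨δ, ρ, hδ, ?_⟩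
  have hmu : muMatrix * ((mu⁻¹ : Matrix.orthogonalGroup (Fin 4) ℝ) :
      Matrix (Fin 4) (Fin 4) ℝ) = 1 := congrArg Subtype.val (mul_inv_cancel mu)
  change muMatrix * ((w : Matrix.orthogonalGroup (Fin 4) ℝ) : Matrix (Fin 4) (Fin 4) ℝ) *
    ((mu⁻¹ : Matrix.orthogonalGroup (Fin 4) ℝ) : Matrix (Fin 4) (Fin 4) ℝ) = _
  rw [hw, h, hc, Matrix.mul_assoc, hmu, Matrix.mul_one]

/-- The trialitarian automorphism `w ↦ μ w μ⁻¹` of `W(D₄)`. -/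
noncomputable def muConj : weylD4 →* weylD4 where
  toFun w := ⟨mu * (w : Matrix.orthogonalGroup (Fin 4) ℝ) * mu⁻¹, mu_conj_mem w⟩
  map_one' := by
    ext1
    simp
  map_mul' v w := by
    ext1
    simp

/-! ### Galois cohomology with coefficients in `W(D₄)` -/

/-- The absolute Galois group `Γ = Gal(F_s / F)`. -/
abbrev Gamma (F : Type*) [Field F] : Type _ := SeparableClosure F ≃ₐ[F] SeparableClosure F

/-- The cocycles `Γ → W(D₄)` for the trivial action of `Γ`: the group homomorphisms that are
continuous for the discrete topology of `W(D₄)`, i.e. those whose kernel is open. -/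
def Cocycle (F : Type*) [Field F] : Type _ :=
  {φ : Gamma F →* weylD4 // IsOpen (φ.ker : Set (Gamma F))}

/-- Two cocycles are cohomologous if they are conjugate by an element of `W(D₄)`. -/
def cocycleSetoid (F : Type*) [Field F] : Setoid (Cocycle F) where
  r φ ψ := ∃ w : weylD4, ∀ γ, ψ.1 γ = w * φ.1 γ * w⁻¹
  iseqv :=
    { refl := fun φ => ⟨1, fun γ => by simp⟩
      symm := by
        rintro φ ψ ⟨w, h⟩
        exact ⟨w⁻¹, fun γ => by rw [h]; group⟩
      trans := by
        rintro φ ψ χ ⟨v, h⟩ ⟨w, h'⟩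
        exact ⟨w * v, fun γ => by rw [h', h]; group⟩ }

/-- The cohomology set `H¹(F, W(D₄))`. -/
def H1 (F : Type*) [Field F] : Type _ := Quotient (cocycleSetoid F)

/-- The cohomology class of a cocycle. -/
def H1.mk {F : Type*} [Field F] (φ : Cocycle F) : H1 F := Quotient.mk (cocycleSetoid F) φ

/-- The cocycle `γ ↦ μ φ(γ) μ⁻¹`. -/
noncomputable def Cocycle.triality {F : Type*} [Field F] (φ : Cocycle F) : Cocycle F :=
  ⟨muConj.comp φ.1, Subgroup.isOpen_mono
    (fun γ hγ => by
      rw [MonoidHom.mem_ker] at hγ ⊢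
      rw [MonoidHom.comp_apply, hγ, map_one]) φ.2⟩

/-- The action of the trialitarian automorphism `w ↦ μ w μ⁻¹` on `H¹(F, W(D₄))`. -/
noncomputable def H1.triality {F : Type*} [Field F] : H1 F → H1 F :=
  Quotient.map (sa := cocycleSetoid F) (sb := cocycleSetoid F) Cocycle.triality (by
    rintro φ ψ ⟨w, h⟩
    refine ⟨muConj w, fun γ => ?_⟩
    change muConj (ψ.1 γ) = muConj w * muConj (φ.1 γ) * (muConj w)⁻¹
    rw [h, map_mul, map_mul, map_inv])

/-! ### Extensions of étale algebras -/

section Extensions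

variable {F S₀ S : Type*} [Field F] [CommRing S₀] [CommRing S] [Algebra F S₀] [Algebra F S]

/-- `ε : S₀ → S` is an extension of degree `d` of étale `F`-algebras, with `dim S₀ = n`: both
algebras are étale over `F`, and `ε` makes `S` a free `S₀`-module of rank `d`. -/
def IsEtaleExtension (d n : ℕ) (ε : S₀ →ₐ[F] S) : Prop :=
  Algebra.Etale F S₀ ∧ Algebra.Etale F S ∧ Module.finrank F S₀ = n ∧
    letI : Module S₀ S := Module.compHom S ε.toRingHom
    Module.Free S₀ S ∧ Module.finrank S₀ S = d

/-- The action of `Γ` on the set `X(S)` of `F`-algebra homomorphisms `S → F_s`. -/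
noncomputable def galAct (γ : Gamma F) (x : S →ₐ[F] SeparableClosure F) : S →ₐ[F] SeparableClosure F :=
  (γ : SeparableClosure F →ₐ[F] SeparableClosure F).comp x

/-- The set `{± e₁, ± e₂, ± e₃, ± e₄}` in `ℝ⁴`, on which `W(D₄)` acts. -/
def signedBasis : Set (Fin 4 → ℝ) :=
  {v | ∃ i, v = Pi.single i 1 ∨ v = -Pi.single i 1}

/-- The double covering `X(S₀) ← X(S)` attached to `ε : S₀ → S` is isomorphic to the covering
`{1, 2, 3, 4} ← {± e₁, ± e₂, ± e₃, ± e₄}`, `± eᵢ ↦ i`, on which `Γ` acts through the cocycle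
`φ : Γ → W(D₄)`. -/
def IsRepresentedBy (ε : S₀ →ₐ[F] S) (φ : Cocycle F) : Prop :=
  ∃ (β : (S →ₐ[F] SeparableClosure F) ≃ signedBasis)
    (β₀ : (S₀ →ₐ[F] SeparableClosure F) ≃ Fin 4),
    (∀ x, (β x : Fin 4 → ℝ) = Pi.single (β₀ (x.comp ε)) 1 ∨
      (β x : Fin 4 → ℝ) = -Pi.single (β₀ (x.comp ε)) 1) ∧
    (∀ γ x, (β (galAct γ x) : Fin 4 → ℝ) =
      ((φ.1 γ : Matrix.orthogonalGroup (Fin 4) ℝ) : Matrix (Fin 4) (Fin 4) ℝ) *ᵥ (β x)) ∧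
    (∀ γ y,
      ((φ.1 γ : Matrix.orthogonalGroup (Fin 4) ℝ) : Matrix (Fin 4) (Fin 4) ℝ) *ᵥ
          Pi.single (β₀ y) 1 = Pi.single (β₀ (galAct γ y)) 1 ∨
      ((φ.1 γ : Matrix.orthogonalGroup (Fin 4) ℝ) : Matrix (Fin 4) (Fin 4) ℝ) *ᵥ
          Pi.single (β₀ y) 1 = -Pi.single (β₀ (galAct γ y)) 1)

/-- `ξ ∈ H¹(F, W(D₄))` is the class of the extension `ε : S₀ → S` for one of the orientations of
the extension. Equivalently, the isomorphism class of `ε` is the image of `ξ` under the map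
`H¹(F, W(D₄)) → H¹(F, 𝔖₂ ≀ 𝔖₄)` that forgets the orientation. -/
def HasClass (ε : S₀ →ₐ[F] S) (ξ : H1 F) : Prop :=
  ∃ φ : Cocycle F, H1.mk φ = ξ ∧ IsRepresentedBy ε φ

end Extensions

/-! ### Extensions given by polynomials -/

section Polynomials

variable {F : Type*} [Field F]

/-- The homomorphism `F[x]/(f(x)) → F[x]/(f(x²))` that maps `x` to `x²`. -/
noncomputable def squareExt (f : F[X]) : AdjoinRoot f →ₐ[F] AdjoinRoot (f.comp (X ^ 2)) :=
  AdjoinRoot.liftAlgHom f (Algebra.ofId F _) (AdjoinRoot.root (f.comp (X ^ 2)) ^ 2) (by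
    have h := AdjoinRoot.eval₂_root (f.comp (X ^ 2))
    rw [eval₂_comp, eval₂_pow, eval₂_X] at h
    exact h)

/-- The extension `ε : S₀ → S` is given by the polynomial `f`: it is isomorphic to
`F[x]/(f(x)) → F[x]/(f(x²))`, `x ↦ x²`. -/
def IsGivenBy {S₀ S : Type*} [CommRing S₀] [CommRing S] [Algebra F S₀] [Algebra F S]
    (ε : S₀ →ₐ[F] S) (f : F[X]) : Prop :=
  ∃ (i₀ : AdjoinRoot f ≃ₐ[F] S₀) (i : AdjoinRoot (f.comp (X ^ 2)) ≃ₐ[F] S),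
    ∀ z, ε (i₀ z) = i (squareExt f z)

/-- `f₄ = x⁴ + a x³ + b x² + c x + e²`. -/
noncomputable def quartic (a b c e : F) : F[X] :=
  X ^ 4 + C a * X ^ 3 + C b * X ^ 2 + C c * X + C (e ^ 2)

/-- The quartic `f₄'`. -/
noncomputable def quartic' (a b c e : F) : F[X] :=
  X ^ 4 + C a * X ^ 3 + C (3 / 8 * a ^ 2 - 1 / 2 * b + 3 * e) * X ^ 2 +
    C (1 / 16 * a ^ 3 - 1 / 4 * a * b + c + 1 / 2 * a * e) * X +
    C ((1 / 16 * a ^ 2 - 1 / 4 * b - 1 / 2 * e) ^ 2)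

/-- The quartic `f₄''`. -/
noncomputable def quartic'' (a b c e : F) : F[X] :=
  X ^ 4 + C a * X ^ 3 + C (3 / 8 * a ^ 2 - 1 / 2 * b - 3 * e) * X ^ 2 +
    C (1 / 16 * a ^ 3 - 1 / 4 * a * b + c - 1 / 2 * a * e) * X +
    C ((1 / 16 * a ^ 2 - 1 / 4 * b + 1 / 2 * e) ^ 2)

end Polynomials

end Triality

/-! Over `F_s` write the roots of `f₄(x²)` as `± t₀, …, ± t₃`, with signs chosen so that `t₀ t₁ t₂
t₃ = e`. This is possible because the constant term of `f₄` is `e²`. Each `γ ∈ Γ` permutes the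
roots, so `γ(t) = t · φ(γ)` for the row vector `t` and a signed permutation matrix `φ(γ)`. As `γ`
fixes the nonzero product `e`, the signs of `φ(γ)` multiply to `1`. Hence `φ` takes values in
`W(D₄)`, and it represents the extension (`exists_isEquivariant`, `isRepresentedBy_squareExt`).

Now put `t' = t μᵀ`. Since `μ` is orthogonal, `γ(t') = t φ(γ) μᵀ = t' · μ φ(γ) μ⁻¹`, so `t'` belongs
to the cocycle twisted by triality (`IsEquivariant.triality`). The `t'ᵢ²` are the roots of `f₄'`, by
computing symmetric functions (`IsRootFrame.triality`). They are distinct because `μ` permutes the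
roots `± eᵢ ± eⱼ` of `D₄`, so that each `t'ᵢ² - t'ⱼ²` is a product of a sum and a difference of
entries of `t` (`IsRegularFrame.triality`). What can fail is only `t'ᵢ ≠ 0`, and the hypothesis on
`f₄'` says that the product of the `t'ᵢ` is nonzero.

Applying the construction twice gives `f₄''` (`quartic''_eq`). The second step does not need the
`t'ᵢ` to be nonzero, so the two claims are independent. -/

namespace Triality

/-! ### Étale algebras `F[x]/(f)` and the quadratic extension `F[x]/(f(x²))` -/

section Etale

variable {F : Type*} [Field F]

/-- The homomorphism `F[x]/(f) → B` that maps `x` to a given root of `f`. -/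
noncomputable def evalRoot {B : Type*} [CommRing B] [Algebra F B] (f : F[X]) (s : B)
    (hs : aeval s f = 0) : AdjoinRoot f →ₐ[F] B :=
  AdjoinRoot.liftAlgHom f (Algebra.ofId F B) s hs

@[simp]
theorem evalRoot_root {B : Type*} [CommRing B] [Algebra F B] (f : F[X]) (s : B)
    (hs : aeval s f = 0) : evalRoot f s hs (AdjoinRoot.root f) = s :=
  AdjoinRoot.liftAlgHom_root f (Algebra.ofId F B) s hs

/-- A multiple root `r` gives two homomorphisms to the dual numbers, `x ↦ r` and `x ↦ r + ε`, that
agree modulo `ε`. Unramifiedness would force them to be equal. -/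
theorem separable_of_formallyUnramified (f : F[X]) [Algebra.FormallyUnramified F (AdjoinRoot f)] :
    f.Separable := by
  rw [separable_def, isCoprime_iff_aeval_ne_zero_of_isAlgClosed F (AlgebraicClosure F)]
  intro r
  by_contra! h
  obtain ⟨h0, h1⟩ := h
  let B := DualNumber (AlgebraicClosure F)
  let d : B := DualNumber.eps
  have hd : d ^ 2 = 0 := by rw [sq]; exact DualNumber.eps_mul_eps
  let s : B := algebraMap (AlgebraicClosure F) B r
  have hs0 : aeval s f = 0 := by
    rw [aeval_algebraMap_apply, h0, map_zero]
  have hs1 : aeval s (derivative f) = 0 := by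
    rw [aeval_algebraMap_apply, h1, map_zero]
  have hsd : aeval (s + d) f = 0 := by
    rw [aeval_add_of_sq_eq_zero _ _ _ hd, hs0, hs1, zero_mul, add_zero]
  let g₁ : AdjoinRoot f →ₐ[F] B := evalRoot f s hs0
  let g₂ : AdjoinRoot f →ₐ[F] B := evalRoot f (s + d) hsd
  have hI : IsNilpotent (Ideal.span {d}) :=
    ⟨2, by rw [Ideal.span_singleton_pow, hd]; simp⟩
  have hg : (Ideal.Quotient.mkₐ F (Ideal.span {d})).comp g₁ =
      (Ideal.Quotient.mkₐ F (Ideal.span {d})).comp g₂ := by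
    apply AdjoinRoot.algHom_ext
    simp only [AlgHom.comp_apply, g₁, g₂, evalRoot_root, Ideal.Quotient.mkₐ_eq_mk]
    rw [eq_comm, Ideal.Quotient.eq]
    simp
  have heq : g₁ = g₂ :=
    Algebra.FormallyUnramified.ext (Ideal.span {d}) hI fun x => DFunLike.congr_fun hg x
  have hr := DFunLike.congr_fun heq (AdjoinRoot.root f)
  simp only [g₁, g₂, evalRoot_root, left_eq_add] at hr
  have := congrArg TrivSqZeroExt.snd hr
  simp [d] at this

/-- Two lifts of the same homomorphism modulo a square-zero ideal send the root to `s` and `s + d`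
with `d² = 0`. Then `0 = f(s + d) = f'(s) d`, and `f'(s)` is a unit by the Bézout relation. Over a
field, unramified of finite type implies étale. -/
theorem etale_adjoinRoot {f : F[X]} (hf : f.Separable) : Algebra.Etale F (AdjoinRoot f) := by
  have hfin : Module.Finite F (AdjoinRoot f) := (AdjoinRoot.powerBasis hf.ne_zero).finite
  have hfp : Algebra.FinitePresentation F (AdjoinRoot f) :=
    Algebra.FinitePresentation.of_finiteType.1 inferInstance
  have hroot : IsUnit (aeval (AdjoinRoot.root f) (derivative f)) := by
    obtain ⟨u, v, huv⟩ := hf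
    have h := congrArg (aeval (AdjoinRoot.root f)) huv
    rw [map_add, map_mul, map_mul, map_one, AdjoinRoot.aeval_eq, AdjoinRoot.aeval_eq f,
      AdjoinRoot.mk_self, mul_zero, zero_add] at h
    exact IsUnit.of_mul_eq_one_right _ h
  have hun : Algebra.FormallyUnramified F (AdjoinRoot f) := by
    rw [Algebra.FormallyUnramified.iff_comp_injective]
    intro B _ _ I hI g₁ g₂ hg
    apply AdjoinRoot.algHom_ext
    have hd := (Ideal.Quotient.eq (I := I)).1
      (DFunLike.congr_fun hg (AdjoinRoot.root f)).symm
    set d := g₂ (AdjoinRoot.root f) - g₁ (AdjoinRoot.root f) with hd_def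
    have hd2 : d ^ 2 = 0 := by
      have := Ideal.pow_mem_pow hd 2
      rwa [hI, Ideal.mem_bot] at this
    have h := aeval_add_of_sq_eq_zero f (g₁ (AdjoinRoot.root f)) d hd2
    rw [hd_def, add_sub_cancel, aeval_algHom_apply, aeval_algHom_apply, aeval_algHom_apply,
      AdjoinRoot.aeval_eq f, AdjoinRoot.mk_self, map_zero, map_zero, zero_add, ← hd_def,
      eq_comm, (hroot.map g₁).mul_right_eq_zero] at h
    exact (sub_eq_zero.1 h).symm
  exact ⟨Algebra.FormallyEtale.of_formallyUnramified_of_field F _, hfp⟩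

theorem finrank_adjoinRoot {f : F[X]} (hf : f ≠ 0) :
    Module.finrank F (AdjoinRoot f) = f.natDegree := by
  rw [(AdjoinRoot.powerBasis hf).finrank, AdjoinRoot.powerBasis_dim]

theorem squareExt_root (f : F[X]) :
    squareExt f (AdjoinRoot.root f) = AdjoinRoot.root (f.comp (X ^ 2)) ^ 2 :=
  AdjoinRoot.liftAlgHom_root f (Algebra.ofId F _) _ _

/-- The basis is `1, x`. Even and odd powers of `x` show that it spans. -/
theorem free_squareExt {f : F[X]} (hf : f ≠ 0) (hdeg : f.natDegree ≠ 0) :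
    letI : Module (AdjoinRoot f) (AdjoinRoot (f.comp (X ^ 2))) :=
      Module.compHom _ (squareExt f).toRingHom
    Module.Free (AdjoinRoot f) (AdjoinRoot (f.comp (X ^ 2))) ∧
      Module.finrank (AdjoinRoot f) (AdjoinRoot (f.comp (X ^ 2))) = 2 := by
  let : Module (AdjoinRoot f) (AdjoinRoot (f.comp (X ^ 2))) :=
    Module.compHom _ (squareExt f).toRingHom
  have hsmul (u : AdjoinRoot f) (z : AdjoinRoot (f.comp (X ^ 2))) :
      u • z = squareExt f u * z := rfl
  have hf2 : f.comp (X ^ 2) ≠ 0 := by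
    intro h
    have := congrArg natDegree h
    rw [natDegree_comp, natDegree_X_pow, natDegree_zero] at this
    omega
  have : Module.Finite F (AdjoinRoot f) := (AdjoinRoot.powerBasis hf).finite
  have : Module.Finite F (AdjoinRoot (f.comp (X ^ 2))) := (AdjoinRoot.powerBasis hf2).finite
  have : Nontrivial (AdjoinRoot f) := AdjoinRoot.nontrivial f fun h =>
    hdeg (natDegree_eq_zero_iff_degree_le_zero.2 h.le)
  set x := AdjoinRoot.root (f.comp (X ^ 2)) with hx
  let L : (Fin 2 → AdjoinRoot f) →ₗ[AdjoinRoot f] AdjoinRoot (f.comp (X ^ 2)) :=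
    Fintype.linearCombination (AdjoinRoot f) ![1, x]
  have hL (p : Fin 2 → AdjoinRoot f) :
      L p = squareExt f (p 0) + squareExt f (p 1) * x := by
    simp [L, Fintype.linearCombination_apply, Fin.sum_univ_two, hsmul]
  let LF : (Fin 2 → AdjoinRoot f) →ₗ[F] AdjoinRoot (f.comp (X ^ 2)) :=
    { toFun := L
      map_add' := L.map_add
      map_smul' := fun r p => by simp [hL] }
  have hsurj : Function.Surjective LF := by
    rw [← LinearMap.range_eq_top, eq_top_iff]
    rintro z -
    obtain ⟨p, rfl⟩ := AdjoinRoot.mk_surjective z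
    induction p using Polynomial.induction_on' with
    | add p q hp hq => rw [map_add]; exact add_mem hp hq
    | monomial n r =>
      rw [← C_mul_X_pow_eq_monomial, ← smul_eq_C_mul, ← AdjoinRoot.smul_mk, map_pow,
        AdjoinRoot.mk_X, ← hx]
      refine Submodule.smul_mem _ r ?_
      obtain ⟨m, rfl | rfl⟩ := n.even_or_odd'
      · refine ⟨![AdjoinRoot.root f ^ m, 0], ?_⟩
        simp [LF, hL, squareExt_root, hx, pow_mul]
      · refine ⟨![0, AdjoinRoot.root f ^ m], ?_⟩
        simp [LF, hL, squareExt_root, hx, pow_mul, pow_succ]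
  -- Both sides have `F`-dimension `2 deg f`, so surjectivity suffices.
  have hinj : Function.Injective LF := by
    rw [LinearMap.injective_iff_surjective_of_finrank_eq_finrank]
    · exact hsurj
    · rw [Module.finrank_pi_fintype, finrank_adjoinRoot hf2, natDegree_comp, natDegree_X_pow]
      simp [finrank_adjoinRoot hf, mul_comm]
  let e := LinearEquiv.ofBijective L ⟨hinj, hsurj⟩
  refine ⟨Module.Free.of_equiv e, ?_⟩
  rw [← e.finrank_eq]
  simp

theorem isEtaleExtension_squareExt {f : F[X]} (hf : f.Separable)
    (hf2 : (f.comp (X ^ 2)).Separable) (hdeg : f.natDegree ≠ 0) :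
    IsEtaleExtension 2 f.natDegree (squareExt f) :=
  ⟨etale_adjoinRoot hf, etale_adjoinRoot hf2, finrank_adjoinRoot hf.ne_zero,
    free_squareExt hf.ne_zero hdeg⟩

end Etale

/-! ### Quadruples of square roots and the action of `μ` on them -/

section Frames

variable {K : Type*} [Field K]

/-- The quadruple obtained from the row vector `t` by right multiplication with `μᵀ`. -/
def trialityFrame (t : Fin 4 → K) : Fin 4 → K :=
  ![(t 0 + t 1 + t 2 - t 3) / 2, (t 0 + t 1 - t 2 + t 3) / 2,
    (t 0 - t 1 + t 2 + t 3) / 2, (t 0 - t 1 - t 2 - t 3) / 2]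

/-- The `± tᵢ` are the roots of `f(x²)` for `f = x⁴ + a x³ + b x² + c x + e²`, and the `tᵢ` have
product `e`. -/
structure IsRootFrame (t : Fin 4 → K) (a b c e : K) : Prop where
  a_eq : a = -(t 0 ^ 2 + t 1 ^ 2 + t 2 ^ 2 + t 3 ^ 2)
  b_eq : b = (t 0 * t 1) ^ 2 + (t 0 * t 2) ^ 2 + (t 0 * t 3) ^ 2 + (t 1 * t 2) ^ 2 +
    (t 1 * t 3) ^ 2 + (t 2 * t 3) ^ 2
  c_eq : c = -((t 0 * t 1 * t 2) ^ 2 + (t 0 * t 1 * t 3) ^ 2 + (t 0 * t 2 * t 3) ^ 2 +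
    (t 1 * t 2 * t 3) ^ 2)
  e_eq : e = t 0 * t 1 * t 2 * t 3

theorem IsRootFrame.quartic_eq {t : Fin 4 → K} {a b c e : K} (h : IsRootFrame t a b c e) :
    quartic a b c e = ∏ i, (X - C (t i ^ 2)) := by
  obtain ⟨rfl, rfl, rfl, rfl⟩ := h
  simp only [quartic, Fin.prod_univ_four, map_add, map_neg, map_mul, map_pow]
  ring

/-- The coefficient `a` is preserved because `μ` is orthogonal. The others are polynomial identities
in the `tᵢ`. The choice of sign of `e` matters: replacing `e` by `-e` exchanges `f₄'` and `f₄''`. -/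
theorem IsRootFrame.triality (h2 : (2 : K) ≠ 0) {t : Fin 4 → K} {a b c e : K}
    (h : IsRootFrame t a b c e) :
    IsRootFrame (trialityFrame t) a (3 / 8 * a ^ 2 - 1 / 2 * b + 3 * e)
      (1 / 16 * a ^ 3 - 1 / 4 * a * b + c + 1 / 2 * a * e)
      (1 / 16 * a ^ 2 - 1 / 4 * b - 1 / 2 * e) := by
  have h4 : (4 : K) ≠ 0 := by
    have := mul_ne_zero h2 h2
    norm_num at this
    exact this
  have h8 : (8 : K) ≠ 0 := by
    have := mul_ne_zero h4 h2
    norm_num at this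
    exact this
  have h16 : (16 : K) ≠ 0 := by
    have := mul_ne_zero h8 h2
    norm_num at this
    exact this
  obtain ⟨rfl, rfl, rfl, rfl⟩ := h
  constructor <;> simp only [trialityFrame, Matrix.cons_val] <;> field_simp <;> ring

/-- The differences and sums `tᵢ ± tⱼ`, `i ≠ j`, do not vanish. -/
def IsRegularFrame (t : Fin 4 → K) : Prop :=
  ∀ i j, i ≠ j → t i ^ 2 ≠ t j ^ 2

/-- Since `μ` permutes the roots of `D₄`, the factors of `t'ᵢ² - t'ⱼ²` are again of the form `tₖ ±
tₗ`; for instance `t'₀² - t'₁² = (t₀ + t₁)(t₂ - t₃)`. -/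
theorem IsRegularFrame.triality (h2 : (2 : K) ≠ 0) {t : Fin 4 → K} (h : IsRegularFrame t) :
    IsRegularFrame (trialityFrame t) := by
  have key : ∀ i j, i < j → trialityFrame t i ^ 2 ≠ trialityFrame t j ^ 2 := by
    intro i j hij heq
    have hs (k l : Fin 4) (hkl : k ≠ l) : t k - t l ≠ 0 ∧ t k + t l ≠ 0 := by
      constructor <;> intro h0 <;> refine h k l hkl ?_ <;> rw [← sub_eq_zero, sq_sub_sq, h0] <;>
        simp
    rw [← sub_eq_zero] at heq
    fin_cases i <;> fin_cases j <;> first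
      | exact absurd hij (by decide)
      | skip
    · exact mul_ne_zero (hs 0 1 (by decide)).2 (hs 2 3 (by decide)).1 (by
        rw [← heq]; simp only [trialityFrame, Fin.reduceFinMk, Matrix.cons_val]; field_simp; ring)
    · exact mul_ne_zero (hs 0 2 (by decide)).2 (hs 1 3 (by decide)).1 (by
        rw [← heq]; simp only [trialityFrame, Fin.reduceFinMk, Matrix.cons_val]; field_simp; ring)
    · exact mul_ne_zero (hs 1 2 (by decide)).2 (hs 0 3 (by decide)).1 (by
        rw [← heq]; simp only [trialityFrame, Fin.reduceFinMk, Matrix.cons_val]; field_simp; ring)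
    · exact mul_ne_zero (hs 0 3 (by decide)).2 (hs 1 2 (by decide)).1 (by
        rw [← heq]; simp only [trialityFrame, Fin.reduceFinMk, Matrix.cons_val]; field_simp; ring)
    · exact mul_ne_zero (hs 1 3 (by decide)).2 (hs 0 2 (by decide)).1 (by
        rw [← heq]; simp only [trialityFrame, Fin.reduceFinMk, Matrix.cons_val]; field_simp; ring)
    · exact mul_ne_zero (hs 2 3 (by decide)).2 (hs 0 1 (by decide)).1 (by
        rw [← heq]; simp only [trialityFrame, Fin.reduceFinMk, Matrix.cons_val]; field_simp; ring)
  intro i j hij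
  rcases lt_or_gt_of_ne hij with h | h
  · exact key i j h
  · exact (key j i h).symm

end Frames

/-! ### The roots `± tᵢ` of `f(x²)` -/

section Roots

variable {K : Type*} [Field K]

/-- The root `± tᵢ` of `∏ (x² - tᵢ²)`. -/
def signedRoot (t : Fin 4 → K) (p : Fin 4 × ℤˣ) : K :=
  ((p.2 : ℤ) : K) * t p.1

theorem cast_unit_sq (u : ℤˣ) : (((u : ℤ) : K)) ^ 2 = 1 := by
  rcases Int.units_eq_one_or u with rfl | rfl <;> simp

theorem cast_unit_mul_self (u : ℤˣ) : ((u : ℤ) : K) * ((u : ℤ) : K) = 1 := by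
  rw [← sq, cast_unit_sq]

theorem signedRoot_sq (t : Fin 4 → K) (p : Fin 4 × ℤˣ) : signedRoot t p ^ 2 = t p.1 ^ 2 := by
  rw [signedRoot, mul_pow, cast_unit_sq, one_mul]

theorem IsRegularFrame.injective_sq {t : Fin 4 → K} (h : IsRegularFrame t) :
    Function.Injective fun i => t i ^ 2 :=
  fun i j hij => by_contra fun hne => h i j hne hij

theorem cast_unit_injective (h2 : (2 : K) ≠ 0) :
    Function.Injective fun u : ℤˣ => ((u : ℤ) : K) := by
  have h : (1 : K) ≠ -1 := fun h => h2 (by linear_combination h)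
  intro u v huv
  rcases Int.units_eq_one_or u with rfl | rfl <;> rcases Int.units_eq_one_or v with rfl | rfl
  · rfl
  · exact absurd (by simpa using huv) h
  · exact absurd (by simpa using huv.symm) h
  · rfl

theorem IsRegularFrame.injective_signedRoot (h2 : (2 : K) ≠ 0) {t : Fin 4 → K}
    (h : IsRegularFrame t) (h0 : ∀ i, t i ≠ 0) : Function.Injective (signedRoot t) := by
  rintro ⟨i, u⟩ ⟨j, v⟩ hp
  have hij : i = j := h.injective_sq (by
    change t i ^ 2 = t j ^ 2
    rw [← signedRoot_sq t (i, u), hp, signedRoot_sq])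
  subst hij
  exact Prod.ext rfl (cast_unit_injective h2 (mul_right_cancel₀ (h0 i) hp))

theorem exists_signedRoot_eq {t : Fin 4 → K} {i : Fin 4} {s : K} (h : s ^ 2 = t i ^ 2) :
    ∃ u, signedRoot t (i, u) = s := by
  rcases sq_eq_sq_iff_eq_or_eq_neg.1 h with h | h
  · exact ⟨1, by simp [signedRoot, h]⟩
  · exact ⟨-1, by simp [signedRoot, h]⟩

theorem prod_X_sub_C_signedRoot (t : Fin 4 → K) :
    ∏ p, (X - C (signedRoot t p)) = (∏ i, (X - C (t i ^ 2))).comp (X ^ 2) := by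
  rw [prod_comp, Fintype.prod_prod_type]
  refine Finset.prod_congr rfl fun i _ => ?_
  rw [show (Finset.univ : Finset ℤˣ) = {1, -1} from rfl, Finset.prod_pair (by decide)]
  simp [signedRoot]
  ring

end Roots

/-! ### Separability, and the points of `X(S₀)` and `X(S)` -/

section Field

variable {F K : Type*} [Field F] [Field K] [Algebra F K] {f : F[X]} {t : Fin 4 → K}

theorem separable_of_map_eq (hf : f.map (algebraMap F K) = ∏ i, (X - C (t i ^ 2)))
    (h : IsRegularFrame t) : f.Separable := by
  rw [← separable_map (algebraMap F K), hf]
  exact separable_prod_X_sub_C_iff.2 h.injective_sq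

theorem separable_comp_of_map_eq (h2 : (2 : K) ≠ 0)
    (hf : f.map (algebraMap F K) = ∏ i, (X - C (t i ^ 2)))
    (h : IsRegularFrame t) (h0 : ∀ i, t i ≠ 0) : (f.comp (X ^ 2)).Separable := by
  rw [← separable_map (algebraMap F K), map_comp, hf, Polynomial.map_pow, map_X,
    ← prod_X_sub_C_signedRoot]
  exact separable_prod_X_sub_C_iff.2 (h.injective_signedRoot h2 h0)

theorem aeval_eq_zero_iff (hf : f.map (algebraMap F K) = ∏ i, (X - C (t i ^ 2))) {s : K} :
    aeval s f = 0 ↔ ∃ i, s = t i ^ 2 := by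
  rw [← eval_map_algebraMap, hf, eval_prod]
  simp [Finset.prod_eq_zero_iff, sub_eq_zero]

theorem aeval_comp_eq_zero_iff (hf : f.map (algebraMap F K) = ∏ i, (X - C (t i ^ 2))) {s : K} :
    aeval s (f.comp (X ^ 2)) = 0 ↔ ∃ p, signedRoot t p = s := by
  rw [aeval_comp, aeval_X_pow, aeval_eq_zero_iff hf]
  constructor
  · rintro ⟨i, hi⟩
    obtain ⟨u, hu⟩ := exists_signedRoot_eq hi
    exact ⟨_, hu⟩
  · rintro ⟨p, rfl⟩
    exact ⟨p.1, signedRoot_sq t p⟩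

/-- The points of `X(S₀)` for `S₀ = F[x]/(f)` are the roots `tᵢ²` of `f`. -/
noncomputable def basePoints (hf : f.map (algebraMap F K) = ∏ i, (X - C (t i ^ 2)))
    (h : IsRegularFrame t) : Fin 4 ≃ (AdjoinRoot f →ₐ[F] K) :=
  Equiv.ofBijective (fun i => evalRoot f (t i ^ 2) ((aeval_eq_zero_iff hf).2 ⟨i, rfl⟩)) <| by
    constructor
    · intro i j hij
      have := DFunLike.congr_fun hij (AdjoinRoot.root f)
      simp only [evalRoot_root] at this
      exact h.injective_sq this
    · intro y
      obtain ⟨i, hi⟩ := (aeval_eq_zero_iff hf (s := y (AdjoinRoot.root f))).1 (by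
        rw [aeval_algHom_apply, AdjoinRoot.aeval_eq, AdjoinRoot.mk_self, map_zero])
      exact ⟨i, AdjoinRoot.algHom_ext (by rw [evalRoot_root, hi])⟩

theorem basePoints_root (hf : f.map (algebraMap F K) = ∏ i, (X - C (t i ^ 2)))
    (h : IsRegularFrame t) (i : Fin 4) : basePoints hf h i (AdjoinRoot.root f) = t i ^ 2 :=
  evalRoot_root _ _ _

/-- The points of `X(S)` for `S = F[x]/(f(x²))` are the roots `± tᵢ` of `f(x²)`. -/
noncomputable def coverPoints (h2 : (2 : K) ≠ 0)
    (hf : f.map (algebraMap F K) = ∏ i, (X - C (t i ^ 2)))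
    (h : IsRegularFrame t) (h0 : ∀ i, t i ≠ 0) :
    Fin 4 × ℤˣ ≃ (AdjoinRoot (f.comp (X ^ 2)) →ₐ[F] K) :=
  Equiv.ofBijective (fun p => evalRoot _ (signedRoot t p)
    ((aeval_comp_eq_zero_iff hf).2 ⟨p, rfl⟩)) <| by
    constructor
    · intro p q hpq
      have := DFunLike.congr_fun hpq (AdjoinRoot.root _)
      simp only [evalRoot_root] at this
      exact h.injective_signedRoot h2 h0 this
    · intro y
      obtain ⟨p, hp⟩ := (aeval_comp_eq_zero_iff hf (s := y (AdjoinRoot.root _))).1 (by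
        rw [aeval_algHom_apply, AdjoinRoot.aeval_eq, AdjoinRoot.mk_self, map_zero])
      exact ⟨p, AdjoinRoot.algHom_ext (by rw [evalRoot_root, hp])⟩

theorem coverPoints_root (h2 : (2 : K) ≠ 0)
    (hf : f.map (algebraMap F K) = ∏ i, (X - C (t i ^ 2)))
    (h : IsRegularFrame t) (h0 : ∀ i, t i ≠ 0) (p : Fin 4 × ℤˣ) :
    coverPoints h2 hf h h0 p (AdjoinRoot.root _) = signedRoot t p :=
  evalRoot_root _ _ _

theorem coverPoints_comp_squareExt (h2 : (2 : K) ≠ 0)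
    (hf : f.map (algebraMap F K) = ∏ i, (X - C (t i ^ 2)))
    (h : IsRegularFrame t) (h0 : ∀ i, t i ≠ 0) (p : Fin 4 × ℤˣ) :
    (coverPoints h2 hf h h0 p).comp (squareExt f) = basePoints hf h p.1 := by
  apply AdjoinRoot.algHom_ext
  rw [basePoints_root, AlgHom.comp_apply, squareExt_root, map_pow, coverPoints_root,
    signedRoot_sq]

end Field

/-- The vector `± eᵢ`. -/
def signedVector (p : Fin 4 × ℤˣ) : Fin 4 → ℝ :=
  ((p.2 : ℤ) : ℝ) • Pi.single p.1 1

theorem signedVector_eq_or (p : Fin 4 × ℤˣ) :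
    signedVector p = Pi.single p.1 1 ∨ signedVector p = -Pi.single p.1 1 := by
  obtain ⟨i, u⟩ := p
  rcases Int.units_eq_one_or u with rfl | rfl
  · exact Or.inl (by simp [signedVector])
  · exact Or.inr (by simp [signedVector])

theorem signedVector_injective : Function.Injective signedVector := by
  rintro ⟨i, u⟩ ⟨j, v⟩ h
  have hi := congrFun h i
  by_cases hij : i = j
  · subst hij
    simp only [signedVector, Pi.smul_apply, Pi.single_eq_same, smul_eq_mul, mul_one] at hi
    rw [cast_unit_injective two_ne_zero hi]
  · simp [signedVector, hij] at hi

/-- The vectors `± eᵢ` are indexed by pairs of an index and a sign. -/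
noncomputable def signedBasisEquiv : Fin 4 × ℤˣ ≃ signedBasis :=
  Equiv.ofBijective (fun p => ⟨signedVector p, p.1, signedVector_eq_or p⟩) <| by
    constructor
    · intro p q h
      exact signedVector_injective (congrArg Subtype.val h)
    · rintro ⟨v, i, rfl | rfl⟩
      · exact ⟨(i, 1), Subtype.ext (by simp [signedVector])⟩
      · exact ⟨(i, -1), Subtype.ext (by simp [signedVector])⟩

theorem signedPerm_mulVec_single (ε : Fin 4 → ℤˣ) (π : Equiv.Perm (Fin 4)) (k : Fin 4) :
    signedPerm ε π *ᵥ Pi.single (π k) 1 = signedVector (k, ε k) := by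
  ext i
  by_cases h : i = k
  · subst h
    simp [signedPerm_apply, signedVector]
  · simp [signedPerm_apply, signedVector, h]

theorem signedPerm_mulVec_signedVector (ε : Fin 4 → ℤˣ) (π : Equiv.Perm (Fin 4)) (k : Fin 4)
    (u : ℤˣ) : signedPerm ε π *ᵥ signedVector (π k, u) = signedVector (k, u * ε k) := by
  have : signedVector (π k, u) = ((u : ℤ) : ℝ) • Pi.single (π k) 1 := rfl
  rw [this, Matrix.mulVec_smul, signedPerm_mulVec_single]
  simp [signedVector, mul_smul]

/-! ### From an equivariant frame to a representing cocycle -/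

section Representation

variable {F : Type*} [Field F] {f : F[X]} {t : Fin 4 → SeparableClosure F}

/-- The group `Γ` acts on the row vector `t` by right multiplication with the matrices `φ(γ)`. -/
def IsEquivariant (φ : Cocycle F) (t : Fin 4 → SeparableClosure F) : Prop :=
  ∀ (γ : Gamma F) (ε : Fin 4 → ℤˣ) (π : Equiv.Perm (Fin 4)),
    ((φ.1 γ : Matrix.orthogonalGroup (Fin 4) ℝ) : Matrix (Fin 4) (Fin 4) ℝ) = signedPerm ε π →
      ∀ i, γ (t (π i)) = ((ε i : ℤ) : SeparableClosure F) * t i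

/-- The bijection matches `± tᵢ` with `± eᵢ`. The right action on rows and the left action on
columns agree here: `γ` sends `t_{π k}` to `εₖ tₖ`, just as the matrix sends `e_{π k}` to `εₖ eₖ`.
-/
theorem isRepresentedBy_squareExt (h2 : (2 : SeparableClosure F) ≠ 0)
    (hf : f.map (algebraMap F (SeparableClosure F)) = ∏ i, (X - C (t i ^ 2)))
    (h : IsRegularFrame t) (h0 : ∀ i, t i ≠ 0) {φ : Cocycle F} (hφ : IsEquivariant φ t) :
    IsRepresentedBy (squareExt f) φ := by
  refine ⟨(coverPoints h2 hf h h0).symm.trans signedBasisEquiv, (basePoints hf h).symm,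
    ?_, ?_, ?_⟩
  · intro x
    obtain ⟨p, rfl⟩ := (coverPoints h2 hf h h0).surjective x
    rw [coverPoints_comp_squareExt, Equiv.trans_apply, Equiv.symm_apply_apply,
      Equiv.symm_apply_apply]
    exact signedVector_eq_or p
  · intro γ x
    obtain ⟨⟨i, u⟩, rfl⟩ := (coverPoints h2 hf h h0).surjective x
    obtain ⟨ε, π, -, hγ⟩ := (φ.1 γ).2
    obtain ⟨k, rfl⟩ := π.surjective i
    have hgal : galAct γ (coverPoints h2 hf h h0 (π k, u)) =
        coverPoints h2 hf h h0 (k, u * ε k) := by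
      apply AdjoinRoot.algHom_ext
      rw [coverPoints_root]
      change γ (coverPoints h2 hf h h0 (π k, u) (AdjoinRoot.root _)) = _
      rw [coverPoints_root]
      simp [signedRoot, hφ γ ε π hγ k, mul_assoc]
    rw [hgal, hγ]
    simp only [Equiv.trans_apply, Equiv.symm_apply_apply]
    exact (signedPerm_mulVec_signedVector ε π k u).symm
  · intro γ y
    obtain ⟨i, rfl⟩ := (basePoints hf h).surjective y
    obtain ⟨ε, π, -, hγ⟩ := (φ.1 γ).2
    obtain ⟨k, rfl⟩ := π.surjective i
    have hgal : galAct γ (basePoints hf h (π k)) = basePoints hf h k := by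
      apply AdjoinRoot.algHom_ext
      rw [basePoints_root]
      change γ (basePoints hf h (π k) (AdjoinRoot.root _)) = _
      rw [basePoints_root, map_pow, hφ γ ε π hγ k, mul_pow, cast_unit_sq, one_mul]
    rw [hgal, hγ, Equiv.symm_apply_apply, Equiv.symm_apply_apply, signedPerm_mulVec_single]
    exact signedVector_eq_or (k, ε k)

theorem IsGivenBy.isRepresentedBy {S₀ S : Type*} [CommRing S₀] [CommRing S] [Algebra F S₀]
    [Algebra F S] {ε : S₀ →ₐ[F] S} (hε : IsGivenBy ε f) {φ : Cocycle F}
    (h : IsRepresentedBy (squareExt f) φ) : IsRepresentedBy ε φ := by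
  obtain ⟨i₀, i, hi⟩ := hε
  obtain ⟨β, β₀, h1, h2, h3⟩ := h
  let e : (S →ₐ[F] SeparableClosure F) ≃ (AdjoinRoot (f.comp (X ^ 2)) →ₐ[F] SeparableClosure F) :=
    i.symm.arrowCongr AlgEquiv.refl
  let e₀ : (S₀ →ₐ[F] SeparableClosure F) ≃ (AdjoinRoot f →ₐ[F] SeparableClosure F) :=
    i₀.symm.arrowCongr AlgEquiv.refl
  have he (x : S →ₐ[F] SeparableClosure F) : (e x).comp (squareExt f) = e₀ (x.comp ε) := by
    refine AlgHom.ext fun z => ?_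
    change x (i (squareExt f z)) = x (ε (i₀ z))
    rw [hi]
  exact ⟨e.trans β, e₀.trans β₀, fun x => by simpa [he] using h1 (e x),
    fun γ x => h2 γ (e x), fun γ y => h3 γ (e₀ y)⟩

end Representation

/-! ### Compatibility of the frame `t μᵀ` with conjugation by `μ` -/

section ConjugationByMu

/-- The integral matrix `2 μ`. -/
def twoMu : Matrix (Fin 4) (Fin 4) ℤ :=
  !![1, 1, 1, -1; 1, 1, -1, 1; 1, -1, 1, 1; 1, -1, -1, -1]

theorem muMatrix_eq_smul_twoMu :
    muMatrix = (1 / 2 : ℝ) • twoMu.map (fun n => (n : ℝ)) := by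
  rw [muMatrix]
  congr 1
  ext i j
  fin_cases i <;> fin_cases j <;> simp [twoMu]

/-- Entry `(i, π k)` of the matrix identity. Clearing the factor `1/2` makes it integral, so that it
can be transferred from `ℝ` to `F_s`. -/
theorem twoMu_apply_mul_of_conj {ε δ : Fin 4 → ℤˣ} {π ρ : Equiv.Perm (Fin 4)}
    (h : muMatrix * signedPerm ε π = signedPerm δ ρ * muMatrix) (i k : Fin 4) :
    twoMu i k * ε k = δ i * twoMu (ρ i) (π k) := by
  rw [muMatrix_eq_smul_twoMu, Matrix.smul_mul, Matrix.mul_smul] at h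
  have h' := congrFun (congrFun (smul_right_injective _ (by norm_num : (1 / 2 : ℝ) ≠ 0) h) i) (π k)
  rw [Matrix.mul_apply, Matrix.mul_apply, Finset.sum_eq_single k,
    Finset.sum_eq_single (ρ i)] at h'
  · simp only [signedPerm_apply, Matrix.map_apply, if_true] at h'
    exact_mod_cast h'
  · intro l _ hl
    rw [signedPerm_apply, if_neg hl.symm, zero_mul]
  · simp
  · intro l _ hl
    rw [signedPerm_apply, if_neg (by simpa using hl), mul_zero]
  · simp

theorem trialityFrame_apply {K : Type*} [Field K] (t : Fin 4 → K) (i : Fin 4) :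
    trialityFrame t i = (∑ j, (twoMu i j : K) * t j) / 2 := by
  fin_cases i <;> simp [trialityFrame, twoMu, Fin.sum_univ_four] <;> ring

theorem IsEquivariant.triality {F : Type*} [Field F] {φ : Cocycle F}
    {t : Fin 4 → SeparableClosure F} (h : IsEquivariant φ t) :
    IsEquivariant φ.triality (trialityFrame t) := by
  intro γ δ ρ hδ i
  obtain ⟨ε, π, -, hγ⟩ := (φ.1 γ).2
  have hconj : muMatrix * signedPerm ε π = signedPerm δ ρ * muMatrix := by
    rw [← hγ, ← hδ]
    have : ((φ.triality.1 γ : weylD4) : Matrix.orthogonalGroup (Fin 4) ℝ) * mu =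
        mu * (φ.1 γ : Matrix.orthogonalGroup (Fin 4) ℝ) := by
      change mu * (φ.1 γ : Matrix.orthogonalGroup (Fin 4) ℝ) * mu⁻¹ * mu = _
      group
    exact (congrArg Subtype.val this).symm
  rw [trialityFrame_apply, trialityFrame_apply, map_div₀, map_ofNat, map_sum,
    ← Equiv.sum_comp π, mul_div_assoc', Finset.mul_sum]
  congr 1
  refine Finset.sum_congr rfl fun k _ => ?_
  rw [map_mul, map_intCast, h γ ε π hγ k]
  have hc := congrArg (fun n : ℤ => (n : SeparableClosure F)) (twoMu_apply_mul_of_conj hconj i k)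
  simp only [Int.cast_mul] at hc
  have hε := cast_unit_mul_self (K := SeparableClosure F) (ε k)
  have hδ := cast_unit_mul_self (K := SeparableClosure F) (δ i)
  -- The entry identity multiplied by `δᵢ εₖ`; the last two terms remove the squares of these signs.
  linear_combination (-((δ i : ℤ) : SeparableClosure F) * ((ε k : ℤ) : SeparableClosure F) * t k) * hc
    + ((δ i : ℤ) : SeparableClosure F) * (twoMu i k : SeparableClosure F) * t k * hε
    - (twoMu (ρ i) (π k) : SeparableClosure F) * ((ε k : ℤ) : SeparableClosure F) * t k * hδ

end ConjugationByMu

/-! ### Construction of the cocycle from the roots -/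

section Existence

variable {F : Type*} [Field F] {f : F[X]} {t : Fin 4 → SeparableClosure F}

/-- The element of `Γ` acts on the row vector `t` by right multiplication with `w`. -/
def ActsBy (t : Fin 4 → SeparableClosure F) (γ : Gamma F) (w : weylD4) : Prop :=
  ∃ (ε : Fin 4 → ℤˣ) (π : Equiv.Perm (Fin 4)),
    ((w : Matrix.orthogonalGroup (Fin 4) ℝ) : Matrix (Fin 4) (Fin 4) ℝ) = signedPerm ε π ∧
      ∀ i, γ (t (π i)) = ((ε i : ℤ) : SeparableClosure F) * t i

theorem signedPerm_injective {ε δ : Fin 4 → ℤˣ} {π ρ : Equiv.Perm (Fin 4)}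
    (h : signedPerm ε π = signedPerm δ ρ) : ε = δ ∧ π = ρ := by
  have key (i : Fin 4) : ε i = δ i ∧ π i = ρ i := by
    have h1 := congrFun (congrFun h i) (π i)
    rw [signedPerm_apply, signedPerm_apply, if_pos rfl] at h1
    split_ifs at h1 with h2
    · exact ⟨cast_unit_injective two_ne_zero h1, h2.symm⟩
    · exact absurd h1 (by exact_mod_cast (ε i).ne_zero)
  exact ⟨funext fun i => (key i).1, Equiv.ext fun i => (key i).2⟩

theorem ActsBy.mul {γ γ' : Gamma F} {w w' : weylD4} (h : ActsBy t γ w) (h' : ActsBy t γ' w') :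
    ActsBy t (γ * γ') (w * w') := by
  obtain ⟨ε, π, hw, ha⟩ := h
  obtain ⟨δ, ρ, hw', ha'⟩ := h'
  refine ⟨fun i => ε i * δ (π i), ρ * π, ?_, fun i => ?_⟩
  · rw [← signedPerm_mul, ← hw, ← hw']
    rfl
  · rw [Equiv.Perm.mul_apply, AlgEquiv.mul_apply, ha', map_mul, map_intCast, ha]
    push_cast
    ring

/-- The eight elements `± tᵢ` are distinct, so each `γ(tₖ)` determines its index and sign. This
uniqueness makes `γ ↦ w` a homomorphism and identifies its kernel. -/
theorem ActsBy.unique (h2 : (2 : SeparableClosure F) ≠ 0) (h : IsRegularFrame t)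
    (h0 : ∀ i, t i ≠ 0) {γ : Gamma F} {w w' : weylD4} (hw : ActsBy t γ w)
    (hw' : ActsBy t γ w') : w = w' := by
  obtain ⟨ε, π, hw, ha⟩ := hw
  obtain ⟨δ, ρ, hw', ha'⟩ := hw'
  have key (k : Fin 4) : π.symm k = ρ.symm k ∧ ε (π.symm k) = δ (ρ.symm k) := by
    have h1 := ha (π.symm k)
    have h3 := ha' (ρ.symm k)
    rw [Equiv.apply_symm_apply] at h1 h3
    have := h.injective_signedRoot h2 h0
      (a₁ := (π.symm k, ε (π.symm k))) (a₂ := (ρ.symm k, δ (ρ.symm k))) (h1.symm.trans h3)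
    exact Prod.ext_iff.1 this
  have hπ : π = ρ := by
    rw [← Equiv.symm_symm π, ← Equiv.symm_symm ρ]
    exact congrArg Equiv.symm (Equiv.ext fun k => (key k).1)
  subst hπ
  have hε : ε = δ := funext fun i => by simpa using (key (π i)).2
  subst hε
  exact Subtype.ext (Subtype.ext (hw.trans hw'.symm))

theorem signedPerm_mem_orthogonalGroup (ε : Fin 4 → ℤˣ) (π : Equiv.Perm (Fin 4)) :
    signedPerm ε π ∈ Matrix.orthogonalGroup (Fin 4) ℝ := by
  rw [Matrix.mem_orthogonalGroup_iff]
  have htr : (signedPerm ε π)ᵀ = signedPerm (fun i => ε (π⁻¹ i)) π⁻¹ := by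
    ext i j
    rw [Matrix.transpose_apply, signedPerm_apply, signedPerm_apply]
    by_cases hij : π j = i
    · subst hij
      simp
    · rw [if_neg hij, if_neg fun h => hij (by rw [← h]; simp)]
  rw [htr, signedPerm_mul, ← signedPerm_one]
  simp

theorem exists_actsBy (h2 : (2 : SeparableClosure F) ≠ 0)
    (hf : f.map (algebraMap F (SeparableClosure F)) = ∏ i, (X - C (t i ^ 2)))
    (h : IsRegularFrame t) (h0 : ∀ i, t i ≠ 0) {e : F}
    (he : ∏ i, t i = algebraMap F (SeparableClosure F) e) (γ : Gamma F) :
    ∃ w, ActsBy t γ w := by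
  have key (i : Fin 4) : ∃ p : Fin 4 × ℤˣ, γ (t p.1) = ((p.2 : ℤ) : SeparableClosure F) * t i := by
    -- The index comes from `γ⁻¹(tᵢ)`, because equivariance is written with `γ` applied to `t (π
    -- i)`.
    obtain ⟨p, hp⟩ := (aeval_comp_eq_zero_iff hf (s := γ.symm (t i))).1 (by
      rw [← AlgEquiv.coe_toAlgHom, aeval_algHom_apply, (aeval_comp_eq_zero_iff hf).2
        ⟨(i, 1), by simp [signedRoot]⟩, map_zero])
    refine ⟨p, ?_⟩
    have hp' := congrArg γ hp
    rw [AlgEquiv.apply_symm_apply, signedRoot, map_mul, map_intCast] at hp'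
    rw [← hp', ← mul_assoc, cast_unit_mul_self, one_mul]
  choose p hp using key
  have hinj : Function.Injective fun i => (p i).1 := by
    intro i j hij
    have hij : (p i).1 = (p j).1 := hij
    apply h.injective_sq
    have := hp i
    rw [hij, hp j] at this
    have := congrArg (· ^ 2) this
    simpa [mul_pow, cast_unit_sq] using this.symm
  let π : Equiv.Perm (Fin 4) := Equiv.ofBijective _ (Finite.injective_iff_bijective.1 hinj)
  have hπ (i : Fin 4) : γ (t (π i)) = (((p i).2 : ℤ) : SeparableClosure F) * t i := hp i
  -- The product of the `tᵢ` lies in `F`, so `γ` fixes it; it is nonzero and can be cancelled.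
  have hprod : ∏ i, (p i).2 = 1 := by
    apply cast_unit_injective h2
    have h1 : γ (∏ i, t i) = ∏ i, t i := by rw [he, AlgEquiv.commutes]
    rw [map_prod, ← Equiv.prod_comp π] at h1
    simp only [hπ, Finset.prod_mul_distrib] at h1
    have h3 := mul_right_cancel₀ (Finset.prod_ne_zero_iff.2 fun i _ => h0 i)
      (h1.trans (one_mul _).symm)
    simpa using h3
  exact ⟨⟨⟨_, signedPerm_mem_orthogonalGroup (fun i => (p i).2) π⟩, _, π, hprod, rfl⟩,
    _, π, rfl, hπ⟩

theorem exists_isEquivariant (h2 : (2 : SeparableClosure F) ≠ 0)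
    (hf : f.map (algebraMap F (SeparableClosure F)) = ∏ i, (X - C (t i ^ 2)))
    (h : IsRegularFrame t) (h0 : ∀ i, t i ≠ 0) {e : F}
    (he : ∏ i, t i = algebraMap F (SeparableClosure F) e) :
    ∃ φ : Cocycle F, IsEquivariant φ t := by
  choose φ hφ using exists_actsBy h2 hf h h0 he
  let Φ : Gamma F →* weylD4 := MonoidHom.mk' φ fun γ γ' =>
    ActsBy.unique h2 h h0 (hφ (γ * γ')) ((hφ γ).mul (hφ γ'))
  have hopen : IsOpen (Φ.ker : Set (Gamma F)) := by
    -- The kernel contains the open subgroup fixing the finite extension `F(t₀, …, t₃)`.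
    let E : IntermediateField F (SeparableClosure F) := IntermediateField.adjoin F (Set.range t)
    have : FiniteDimensional F E := IntermediateField.finiteDimensional_adjoin fun x _ =>
      Algebra.IsIntegral.isIntegral x
    refine Subgroup.isOpen_mono (H₁ := E.fixingSubgroup) (fun γ hγ => ?_)
      E.fixingSubgroup_isOpen
    rw [MonoidHom.mem_ker]
    refine ActsBy.unique h2 h h0 (hφ γ) ⟨fun _ => 1, 1, signedPerm_one.symm, fun i => ?_⟩
    have := (IntermediateField.mem_fixingSubgroup_iff E γ).1 hγ (t i)
      (IntermediateField.subset_adjoin F _ ⟨i, rfl⟩)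
    simpa using this
  refine ⟨⟨Φ, hopen⟩, fun γ δ ρ hγ => ?_⟩
  obtain ⟨ε, π, hw, ha⟩ := hφ γ
  obtain ⟨rfl, rfl⟩ := signedPerm_injective (hw.symm.trans hγ)
  exact ha

end Existence

/-! ### The quartics `f₄`, `f₄'`, `f₄''` and their root frames -/

section Quartic

variable {F : Type*} [Field F]

theorem map_quartic {K : Type*} [Field K] (g : F →+* K) (a b c e : F) :
    (quartic a b c e).map g = quartic (g a) (g b) (g c) (g e) := by
  simp [quartic, Polynomial.map_pow]

theorem natDegree_quartic (a b c e : F) : (quartic a b c e).natDegree = 4 := by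
  unfold quartic
  compute_degree!

theorem monic_quartic (a b c e : F) : (quartic a b c e).Monic := by
  unfold quartic
  monicity!

theorem quartic_inj {a b c e a' b' c' e' : F} (h : quartic a b c e = quartic a' b' c' e') :
    a = a' ∧ b = b' ∧ c = c' ∧ e ^ 2 = e' ^ 2 := by
  have hc (n : ℕ) := congrArg (coeff · n) h
  simp only [quartic, coeff_add, coeff_C_mul, coeff_X_pow, coeff_X, coeff_C] at hc
  exact ⟨by simpa using hc 3, by simpa using hc 2, by simpa using hc 1, by simpa using hc 0⟩

/-- If `e = 0`, then `x²` divides `f₄(x²)`. -/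
theorem e_ne_zero_of_separable {a b c e : F}
    (h : ((quartic a b c e).comp (X ^ 2)).Separable) : e ≠ 0 := by
  rintro rfl
  have hdvd : X * X ∣ (quartic a b c 0).comp (X ^ 2) := by
    refine ⟨X ^ 6 + C a * X ^ 4 + C b * X ^ 2 + C c, ?_⟩
    simp [quartic]
    ring
  exact not_isUnit_X (h.squarefree X hdvd)

theorem exists_isRootFrame (h2 : (2 : SeparableClosure F) ≠ 0) {a b c e : F}
    (h : (quartic a b c e).Separable) :
    ∃ t : Fin 4 → SeparableClosure F, IsRegularFrame t ∧
      IsRootFrame t (algebraMap F _ a) (algebraMap F _ b) (algebraMap F _ c)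
        (algebraMap F _ e) := by
  let K := SeparableClosure F
  let g := algebraMap F K
  have hK : NeZero (2 : K) := ⟨h2⟩
  have hsplit : ((quartic a b c e).map g).Splits := IsSepClosed.splits_codomain _ h
  have hcard : ((quartic a b c e).map g).roots.card = 4 := by
    rw [← hsplit.natDegree_eq_card_roots, natDegree_map, natDegree_quartic]
  obtain ⟨r, hr⟩ : ∃ r : Fin 4 → K, (quartic a b c e).map g = ∏ i, (X - C (r i)) := by
    obtain ⟨x, y, z, w, hs⟩ := Multiset.card_eq_four.1 hcard
    refine ⟨![x, y, z, w], ?_⟩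
    rw [hsplit.eq_prod_roots, ((monic_quartic a b c e).map g).leadingCoeff, hs]
    simp [Fin.prod_univ_four, mul_assoc]
  have hrinj : Function.Injective r := separable_prod_X_sub_C_iff.1 (hr ▸ h.map)
  -- Square roots exist in the separable closure because the characteristic is not `2`.
  choose s hs using fun i => IsSepClosed.exists_eq_mul_self (r i)
  have hs' : IsRootFrame s _ _ _ _ := ⟨rfl, rfl, rfl, rfl⟩
  have heq : quartic (g a) (g b) (g c) (g e) = _ :=
    (map_quartic g a b c e).symm.trans <| hr.trans <|
      Eq.trans (by simp only [hs, sq]) hs'.quartic_eq.symm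
  obtain ⟨ha, hb, hc, he⟩ := quartic_inj heq
  have hreg : IsRegularFrame s := fun i j hij hsq => hij (hrinj (by
    rw [hs, hs, ← sq, ← sq, hsq]))
  -- Comparing constant terms gives the product of the square roots only up to sign. If it is `-e`,
  -- changing the sign of `s 0` corrects it and leaves all squares unchanged.
  rcases sq_eq_sq_iff_eq_or_eq_neg.1 he with he | he
  · exact ⟨s, hreg, ha, hb, hc, he⟩
  · have hsq : ∀ i, ![-s 0, s 1, s 2, s 3] i ^ 2 = s i ^ 2 := by
      intro i
      fin_cases i <;> simp
    refine ⟨![-s 0, s 1, s 2, s 3], fun i j hij => ?_, ha.trans ?_, hb.trans ?_, hc.trans ?_,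
      he.trans ?_⟩
    · rw [hsq, hsq]
      exact hreg i j hij
    all_goals
      simp only [Matrix.cons_val]
      ring

theorem IsRootFrame.map_eq {t : Fin 4 → SeparableClosure F} {a b c e : F}
    (h : IsRootFrame t (algebraMap F _ a) (algebraMap F _ b) (algebraMap F _ c)
      (algebraMap F _ e)) :
    (quartic a b c e).map (algebraMap F (SeparableClosure F)) = ∏ i, (X - C (t i ^ 2)) := by
  rw [map_quartic, h.quartic_eq]

theorem IsRootFrame.ne_zero {K : Type*} [Field K] {t : Fin 4 → K} {a b c e : K}
    (h : IsRootFrame t a b c e) (he : e ≠ 0) (i : Fin 4) : t i ≠ 0 := by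
  have hprod : ∏ i, t i ≠ 0 := by rwa [Fin.prod_univ_four, ← h.e_eq]
  exact Finset.prod_ne_zero_iff.1 hprod i (Finset.mem_univ i)

theorem IsRootFrame.triality_map {K : Type*} [Field K] [Algebra F K] (h2 : (2 : K) ≠ 0)
    {t : Fin 4 → K} {a b c e : F}
    (h : IsRootFrame t (algebraMap F _ a) (algebraMap F _ b) (algebraMap F _ c)
      (algebraMap F _ e)) :
    IsRootFrame (trialityFrame t) (algebraMap F _ a)
      (algebraMap F _ (3 / 8 * a ^ 2 - 1 / 2 * b + 3 * e))
      (algebraMap F _ (1 / 16 * a ^ 3 - 1 / 4 * a * b + c + 1 / 2 * a * e))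
      (algebraMap F _ (1 / 16 * a ^ 2 - 1 / 4 * b - 1 / 2 * e)) := by
  simpa [_root_.map_ofNat (algebraMap F K)] using h.triality h2

theorem IsRootFrame.isEtaleExtension_and_isRepresentedBy (h2 : (2 : SeparableClosure F) ≠ 0)
    {t : Fin 4 → SeparableClosure F} {a b c e : F}
    (h : IsRootFrame t (algebraMap F _ a) (algebraMap F _ b) (algebraMap F _ c)
      (algebraMap F _ e)) (he : e ≠ 0) (hreg : IsRegularFrame t) {φ : Cocycle F}
    (hφ : IsEquivariant φ t) :
    IsEtaleExtension 2 4 (squareExt (quartic a b c e)) ∧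
      IsRepresentedBy (squareExt (quartic a b c e)) φ := by
  have h0 := h.ne_zero ((_root_.map_ne_zero _).2 he)
  refine ⟨?_, isRepresentedBy_squareExt h2 h.map_eq hreg h0 hφ⟩
  have := isEtaleExtension_squareExt (separable_of_map_eq h.map_eq hreg)
    (separable_comp_of_map_eq h2 h.map_eq hreg h0) (by rw [natDegree_quartic]; decide)
  rwa [natDegree_quartic] at this

/-- The product of the entries of the twice transformed frame is the negative of the square root of
`f₄''(0)` used in the statement. The sign affects neither the constant term nor its nonvanishing. -/
theorem triality_e_eq (h2 : (2 : F) ≠ 0) (a b e : F) :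
    1 / 16 * a ^ 2 - 1 / 4 * (3 / 8 * a ^ 2 - 1 / 2 * b + 3 * e) -
      1 / 2 * (1 / 16 * a ^ 2 - 1 / 4 * b - 1 / 2 * e) =
      -(1 / 16 * a ^ 2 - 1 / 4 * b + 1 / 2 * e) := by
  have h4 : (4 : F) ≠ 0 := by simpa [show (4 : F) = 2 * 2 by norm_num] using h2
  have h8 : (8 : F) ≠ 0 := by simpa [show (8 : F) = 2 * 2 * 2 by norm_num] using h2
  have h16 : (16 : F) ≠ 0 := by simpa [show (16 : F) = 2 * 2 * 2 * 2 by norm_num] using h2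
  field_simp
  ring

theorem quartic''_eq (h2 : (2 : F) ≠ 0) (a b c e : F) : quartic'' a b c e =
    quartic' a (3 / 8 * a ^ 2 - 1 / 2 * b + 3 * e)
      (1 / 16 * a ^ 3 - 1 / 4 * a * b + c + 1 / 2 * a * e)
      (1 / 16 * a ^ 2 - 1 / 4 * b - 1 / 2 * e) := by
  have h4 : (4 : F) ≠ 0 := by simpa [show (4 : F) = 2 * 2 by norm_num] using h2
  have h8 : (8 : F) ≠ 0 := by simpa [show (8 : F) = 2 * 2 * 2 by norm_num] using h2
  have h16 : (16 : F) ≠ 0 := by simpa [show (16 : F) = 2 * 2 * 2 * 2 by norm_num] using h2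
  have hb : 3 / 8 * a ^ 2 - 1 / 2 * (3 / 8 * a ^ 2 - 1 / 2 * b + 3 * e) +
      3 * (1 / 16 * a ^ 2 - 1 / 4 * b - 1 / 2 * e) = 3 / 8 * a ^ 2 - 1 / 2 * b - 3 * e := by
    field_simp
    ring
  have hc : 1 / 16 * a ^ 3 - 1 / 4 * a * (3 / 8 * a ^ 2 - 1 / 2 * b + 3 * e) +
      (1 / 16 * a ^ 3 - 1 / 4 * a * b + c + 1 / 2 * a * e) +
      1 / 2 * a * (1 / 16 * a ^ 2 - 1 / 4 * b - 1 / 2 * e) =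
      1 / 16 * a ^ 3 - 1 / 4 * a * b + c - 1 / 2 * a * e := by
    field_simp
    ring
  rw [quartic'', quartic', hb, hc, triality_e_eq h2, neg_sq]

end Quartic

end Triality

/-! ### The theorem -/

open Triality in
theorem mainTheorem3 {F : Type*} [Field F] [Infinite F] (hF : ringChar F ≠ 2)
    {S₀ S : Type*} [CommRing S₀] [CommRing S] [Algebra F S₀] [Algebra F S]
    (ε : S₀ →ₐ[F] S) (hε : Triality.IsEtaleExtension 2 4 ε)
    (a b c e : F) (hf : Triality.IsGivenBy ε (Triality.quartic a b c e)) :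
    ∃ ξ : Triality.H1 F,
      Triality.HasClass ε ξ ∧
      (1 / 16 * a ^ 2 - 1 / 4 * b - 1 / 2 * e ≠ 0 →
        Triality.IsEtaleExtension 2 4 (Triality.squareExt (Triality.quartic' a b c e)) ∧
        Triality.HasClass (Triality.squareExt (Triality.quartic' a b c e)) ξ.triality) ∧
      (1 / 16 * a ^ 2 - 1 / 4 * b + 1 / 2 * e ≠ 0 →
        Triality.IsEtaleExtension 2 4 (Triality.squareExt (Triality.quartic'' a b c e)) ∧
        Triality.HasClass (Triality.squareExt (Triality.quartic'' a b c e))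
          ξ.triality.triality) := by
  have h2F : (2 : F) ≠ 0 := Ring.two_ne_zero hF
  have h2 : (2 : SeparableClosure F) ≠ 0 := by
    rw [← map_ofNat (algebraMap F (SeparableClosure F)) 2]
    exact (_root_.map_ne_zero _).2 h2F
  obtain ⟨hS₀, hS, -⟩ := hε
  -- Étaleness of `S₀` and `S` is carried to the polynomial algebras and gives separability of both
  -- `f₄` and `f₄(x²)`.
  have hsep : (quartic a b c e).Separable ∧ ((quartic a b c e).comp (X ^ 2)).Separable := by
    obtain ⟨i₀, i, -⟩ := hf
    have := Algebra.Etale.of_equiv i₀.symm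
    have := Algebra.Etale.of_equiv i.symm
    exact ⟨separable_of_formallyUnramified _, separable_of_formallyUnramified _⟩
  have he := e_ne_zero_of_separable hsep.2
  obtain ⟨t, hreg, ht⟩ := exists_isRootFrame h2 hsep.1
  obtain ⟨φ, hφ⟩ := exists_isEquivariant h2 ht.map_eq hreg (ht.ne_zero ((_root_.map_ne_zero _).2 he))
    (e := e) (by rw [Fin.prod_univ_four, ht.e_eq])
  refine ⟨H1.mk φ, ⟨φ, rfl, hf.isRepresentedBy
    (ht.isEtaleExtension_and_isRepresentedBy h2 he hreg hφ).2⟩, fun he' => ?_, fun he'' => ?_⟩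
  · obtain ⟨h1, h3⟩ := (ht.triality_map h2).isEtaleExtension_and_isRepresentedBy h2 he'
      (hreg.triality h2) hφ.triality
    exact ⟨h1, φ.triality, rfl, h3⟩
  · rw [quartic''_eq h2F]
    obtain ⟨h1, h3⟩ := ((ht.triality_map h2).triality_map h2).isEtaleExtension_and_isRepresentedBy
      h2 (by rw [triality_e_eq h2F]; exact neg_ne_zero.2 he'') ((hreg.triality h2).triality h2)
      hφ.triality.triality
    exact ⟨h1, φ.triality.triality, rfl, h3⟩
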